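/- Let $a\in\mathbb{R}$ and let $M:\mathbb{R}\to\mathbb{R}$ be a function of class $C^3$ (for example, smooth). On the coordinate domain $(v,r,\vartheta,\psi)$ with $v\in\mathbb{R}$, $r>0$, $0<\vartheta<\pi$ and $\psi$ an angle, put $\rho^2=r^2+a^2\cos^2\vartheta$, $\Delta=r^2-2M(v)r+a^2$, $\Gamma=r^2+a^2$, and let $g$ be the Kerr-Vaidya metric $$ds^2=-\Big(1-\frac{2M(v)r}{\rho^2}\Big)dv^2+2\,dv\,dr-\frac{4M(v)ar\sin^2\vartheta}{\rho^2}\,dv\,d\psi-2a\sin^2\vartheta\,dr\,d\psi+\rho^2\,d\vartheta^2+\frac{\Gamma^2-\Delta a^2\sin^2\vartheta}{\rho^2}\sin^2\vartheta\,d\psi^2 .$$ Let $\nabla$ be its Levi-Civita connection and $G_{ab}=R_{ab}-\tfrac12 R\,g_{ab}$ its Einstein tensor. Then the vector field $K^a=(\partial/\partial v)^a$ generates a Kodama-like time translation symmetry, that is: 1. $K^a$ is divergence-free, $\nabla_aK^a=0$; 2. $K^a$ is tangent to the surfaces of constant $r$, $K^a\nabla_a r=0$; 3. the current $J^a=G^{ab}K_b$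 is differentiable and covariantly conserved, $\nabla_aJ^a=0$. The components of the current are $$J^v=\frac{1}{\rho^6}\,a^2\sin^2\vartheta\,(a^2\cos^2\vartheta-r^2)\,M'(v),$$ $$J^r=\frac{1}{\rho^6}\Big(\big(\rho^4+r^4+r^2a^2\sin^2\vartheta-a^4\cos^2\vartheta\big)M'(v)-r\rho^2a^2\sin^2\vartheta\,M''(v)\Big),$$ $$J^\vartheta=-\frac{1}{\rho^6}\,r\,a^2\sin(2\vartheta)\,M'(v),$$ $$J^\psi=\frac{1}{\rho^6}\,a\,(a^2\cos^2\vartheta-r^2)\,M'(v).$$ Moreover $K^a$ is timelike, i.e. $g_{ab}K^aK^b<0$, exactly at the points where $2M(v)r<\rho^2$. -/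

import Mathlib

open scoped Matrix

noncomputable section

namespace KerrVaidya

/-! Tensor calculus in a coordinate chart with four coordinates. -/

/-- Points of a coordinate chart; here the coordinates are `(v, r, ϑ, ψ) = (x 0, x 1, x 2, x 3)`. -/
abbrev Coord : Type := Fin 4 → ℝ

/-- Components `g_{μν}` of a metric as functions of the coordinates. -/
abbrev Metric : Type := Coord → Matrix (Fin 4) (Fin 4) ℝ

/-- Contravariant components `V^μ` of a vector field. -/
abbrev VField : Type := Coord → Fin 4 → ℝ

/-- The partial derivative `∂_μ f` at `x`. -/
def pd (μ : Fin 4) (f : Coord → ℝ) (x : Coord) : ℝ :=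
  deriv (fun t => f (Function.update x μ t)) (x μ)

/-- The inverse metric `g^{μν}`. -/
def invMetric (g : Metric) (x : Coord) : Matrix (Fin 4) (Fin 4) ℝ := (g x)⁻¹

/-- Christoffel symbols of the Levi-Civita connection,
`Γ^l_{μν} = ½ g^{lk} (∂_μ g_{kν} + ∂_ν g_{kμ} - ∂_k g_{μν})`. -/
def christoffel (g : Metric) (l μ ν : Fin 4) (x : Coord) : ℝ :=
  (1 / 2) * ∑ k, invMetric g x l k *
    (pd μ (fun y => g y k ν) x + pd ν (fun y => g y k μ) x - pd k (fun y => g y μ ν) x)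

/-- Curvature tensor
`R^p_{σμν} = ∂_μ Γ^p_{νσ} - ∂_ν Γ^p_{μσ} + Γ^p_{μl} Γ^l_{νσ} - Γ^p_{νl} Γ^l_{μσ}`. -/
def riemann (g : Metric) (p σ μ ν : Fin 4) (x : Coord) : ℝ :=
  pd μ (christoffel g p ν σ) x - pd ν (christoffel g p μ σ) x
    + ∑ l, (christoffel g p μ l x * christoffel g l ν σ x
      - christoffel g p ν l x * christoffel g l μ σ x)

/-- Ricci tensor `R_{μν} = R^p_{μpν}`. -/
def ricci (g : Metric) (μ ν : Fin 4) (x : Coord) : ℝ :=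
  ∑ p, riemann g p μ p ν x

/-- Scalar curvature `R = g^{μν} R_{μν}`. -/
def scalarCurv (g : Metric) (x : Coord) : ℝ :=
  ∑ μ, ∑ ν, invMetric g x μ ν * ricci g μ ν x

/-- Einstein tensor `G_{μν} = R_{μν} - ½ R g_{μν}`. -/
def einstein (g : Metric) (μ ν : Fin 4) (x : Coord) : ℝ :=
  ricci g μ ν x - (1 / 2) * scalarCurv g x * g x μ ν

/-- Einstein tensor with raised indices, `G^{μν} = g^{μα} g^{νβ} G_{αβ}`. -/
def einsteinUp (g : Metric) (μ ν : Fin 4) (x : Coord) : ℝ :=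
  ∑ α, ∑ β, invMetric g x μ α * invMetric g x ν β * einstein g α β x

/-- The covector `V_μ = g_{μν} V^ν`. -/
def lower (g : Metric) (V : VField) (μ : Fin 4) (x : Coord) : ℝ :=
  ∑ ν, g x μ ν * V x ν

/-- The current `J^μ = G^{μν} V_ν` associated with a vector field `V`. -/
def current (g : Metric) (V : VField) : VField :=
  fun x μ => ∑ ν, einsteinUp g μ ν x * lower g V ν x

/-- Covariant derivative `∇_μ V^ν = ∂_μ V^ν + Γ^ν_{μl} V^l`. -/
def covDeriv (g : Metric) (V : VField) (μ ν : Fin 4) (x : Coord) : ℝ :=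
  pd μ (fun y => V y ν) x + ∑ l, christoffel g ν μ l x * V x l

/-- Covariant divergence `∇_μ V^μ`. -/
def divergence (g : Metric) (V : VField) (x : Coord) : ℝ :=
  ∑ μ, covDeriv g V μ μ x

/-- The derivative `V^μ ∂_μ f` of a scalar function along a vector field. -/
def along (V : VField) (f : Coord → ℝ) (x : Coord) : ℝ :=
  ∑ μ, V x μ * pd μ f x

/-- The square `g_{μν} V^μ V^ν`. -/
def normSq (g : Metric) (V : VField) (x : Coord) : ℝ :=
  ∑ μ, ∑ ν, g x μ ν * V x μ * V x ν

/-! The Kerr-Vaidya metric in ingoing coordinates `(v, r, ϑ, ψ)`. -/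

/-- `ρ² = r² + a² cos² ϑ`. -/
def rhoSq (a : ℝ) (x : Coord) : ℝ := x 1 ^ 2 + a ^ 2 * Real.cos (x 2) ^ 2

/-- `Δ = r² - 2 M(v) r + a²`. -/
def Delta (a : ℝ) (M : ℝ → ℝ) (x : Coord) : ℝ := x 1 ^ 2 - 2 * M (x 0) * x 1 + a ^ 2

/-- `Γ = r² + a²`. -/
def Gam (a : ℝ) (x : Coord) : ℝ := x 1 ^ 2 + a ^ 2

/-- The coordinate domain `r > 0`, `0 < ϑ < π`. The coordinate `v` is any real number, and so is
the angle `ψ` (nothing depends on it, and it may be taken modulo `2π`). -/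
def domain : Set Coord := {x | 0 < x 1 ∧ 0 < x 2 ∧ x 2 < Real.pi}

/-- The Kerr-Vaidya metric with rotation parameter `a` and mass function `M`:
`ds² = -(1 - 2Mr/ρ²) dv² + 2 dv dr - (4Mar sin²ϑ/ρ²) dv dψ - 2a sin²ϑ dr dψ + ρ² dϑ²
  + ((Γ² - Δ a² sin²ϑ)/ρ²) sin²ϑ dψ²`. -/
def metric (a : ℝ) (M : ℝ → ℝ) : Metric := fun x =>
  !![-(1 - 2 * M (x 0) * x 1 / rhoSq a x), 1, 0,
        -(2 * M (x 0) * a * x 1 * Real.sin (x 2) ^ 2 / rhoSq a x);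
     1, 0, 0, -(a * Real.sin (x 2) ^ 2);
     0, 0, rhoSq a x, 0;
     -(2 * M (x 0) * a * x 1 * Real.sin (x 2) ^ 2 / rhoSq a x),
        -(a * Real.sin (x 2) ^ 2), 0,
        (Gam a x ^ 2 - Delta a M x * a ^ 2 * Real.sin (x 2) ^ 2) / rhoSq a x
          * Real.sin (x 2) ^ 2]

/-- The coordinate vector field `K = ∂/∂v`. -/
def K : VField := fun _ => Pi.single 0 1

/-- The determinant is `-(ρ² sin ϑ)²`, so that the metric is non-degenerate on `domain` and
`invMetric` is its inverse there. -/
theorem det_metric (a : ℝ) (M : ℝ → ℝ) (x : Coord) (hx : x ∈ domain) :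
    (metric a M x).det = -(rhoSq a x * Real.sin (x 2)) ^ 2 := by
  have hr : x 1 ^ 2 + a ^ 2 * Real.cos (x 2) ^ 2 ≠ 0 := by
    have := hx.1
    positivity
  have hc : Real.sin (x 2) ^ 2 = 1 - Real.cos (x 2) ^ 2 := Real.sin_sq (x 2)
  have hr' : rhoSq a x ≠ 0 := hr
  have hG : Gam a x = rhoSq a x + a ^ 2 * Real.sin (x 2) ^ 2 := by
    simp only [Gam, rhoSq, hc]; ring
  have hD : Delta a M x = rhoSq a x + a ^ 2 * Real.sin (x 2) ^ 2 - 2 * M (x 0) * x 1 := by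
    simp only [Delta, rhoSq, hc]; ring
  rw [metric, hG, hD, Matrix.det_succ_row_zero]
  simp [Fin.sum_univ_succ, Matrix.det_fin_three, Fin.succAbove]
  field_simp
  ring

end KerrVaidya

end

/-!
On the domain the metric has Kerr–Schild form `g = η + F l ⊗ l` with `η` flat, `F = 2Mr/ρ²` and `l`
null and dual to `∂/∂r`. Its Christoffel symbols are rational in `r`, `sin ϑ`, `cos ϑ`, `F` and the
derivatives of `F`, and they are verified by lowering the upper index, so that `g` is never inverted
explicitly. Since `det g = -(ρ² sin ϑ)²`, traces of Christoffel symbols are logarithmic derivatives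
of `ρ² sin ϑ`; this shortens the Ricci tensor and turns a divergence into an ordinary one.

The Ricci tensor is that of a null fluid, `l ⊗ n + n ⊗ l` with `n` annihilated by `∂/∂r`. Hence the
scalar curvature vanishes, and the current is the vector whose lowered components are `R_{μv}`. As
the claimed current is annihilated by `l`, lowering its index with `g` is the same as with `η`.
-/

noncomputable section

namespace KerrVaidya

open Filter

open scoped Topology

section Jacobi

variable {n : Type*} [Fintype n] [DecidableEq n]

theorem sum_det_updateRow (A B : Matrix n n ℝ) :
    ∑ i, (A.updateRow i (B i)).det = (A.adjugate * B).trace := by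
  rw [Matrix.trace_mul_comm]
  simp only [← Matrix.cramer_transpose_apply, Matrix.cramer_eq_adjugate_mulVec,
    ← Matrix.adjugate_transpose, Matrix.mulVec_transpose, Matrix.vecMul, dotProduct,
    Matrix.trace, Matrix.diag, Matrix.mul_apply]

theorem hasDerivAt_det {A : ℝ → Matrix n n ℝ} {A' : Matrix n n ℝ} {t : ℝ}
    (hA : ∀ i j, HasDerivAt (fun s => A s i j) (A' i j) t) :
    HasDerivAt (fun s => (A s).det) ((A t).adjugate * A').trace t := by
  let det : ContinuousMultilinearMap ℝ (fun _ : n => n → ℝ) ℝ :=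
    { (Matrix.detRowAlternating (n := n) (R := ℝ)).toMultilinearMap with
      cont := Continuous.matrix_det continuous_id }
  have hrows : HasDerivAt (fun s i => A s i) A' t :=
    hasDerivAt_pi.2 fun i => hasDerivAt_pi.2 fun j => hA i j
  rw [← sum_det_updateRow]
  refine ((det.hasFDerivAt (A t)).comp_hasDerivAt t hrows).congr_deriv ?_
  exact det.linearDeriv_apply _ _

end Jacobi

section PartialDerivatives

variable {μ : Fin 4} {f h : Coord → ℝ} {x : Coord}

theorem hasDerivAt_pd (μ : Fin 4) (hf : DifferentiableAt ℝ f x) :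
    HasDerivAt (fun t => f (Function.update x μ t)) (pd μ f x) (x μ) := by
  have hf' : DifferentiableAt ℝ f (Function.update x μ (x μ)) := by
    rwa [Function.update_eq_self]
  exact (hf'.comp (x μ) (hasDerivAt_update x μ (x μ)).differentiableAt).hasDerivAt

theorem pd_congr (μ : Fin 4) (hfh : f =ᶠ[𝓝 x] h) : pd μ f x = pd μ h x := by
  have hu : Tendsto (Function.update x μ) (𝓝 (x μ)) (𝓝 x) := by
    simpa only [Function.update_eq_self] using
      (hasDerivAt_update x μ (x μ)).continuousAt.tendsto
  exact EventuallyEq.deriv_eq (hu.eventually hfh)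

theorem pd_const (μ : Fin 4) (q : ℝ) (x : Coord) : pd μ (fun _ => q) x = 0 :=
  deriv_const _ _

theorem pd_add (hf : DifferentiableAt ℝ f x) (hh : DifferentiableAt ℝ h x) :
    pd μ (fun y => f y + h y) x = pd μ f x + pd μ h x :=
  ((hasDerivAt_pd μ hf).add (hasDerivAt_pd μ hh)).deriv

theorem pd_sub (hf : DifferentiableAt ℝ f x) (hh : DifferentiableAt ℝ h x) :
    pd μ (fun y => f y - h y) x = pd μ f x - pd μ h x :=
  ((hasDerivAt_pd μ hf).sub (hasDerivAt_pd μ hh)).deriv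

theorem pd_neg : pd μ (fun y => -f y) x = -pd μ f x :=
  deriv.fun_neg

theorem pd_mul (hf : DifferentiableAt ℝ f x) (hh : DifferentiableAt ℝ h x) :
    pd μ (fun y => f y * h y) x = pd μ f x * h x + f x * pd μ h x := by
  simpa only [pd, Function.update_eq_self] using
    ((hasDerivAt_pd μ hf).fun_mul (hasDerivAt_pd μ hh)).deriv

theorem pd_pow (hf : DifferentiableAt ℝ f x) (n : ℕ) :
    pd μ (fun y => f y ^ n) x = n * f x ^ (n - 1) * pd μ f x := by
  simpa only [pd, Function.update_eq_self] using ((hasDerivAt_pd μ hf).fun_pow n).deriv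

theorem pd_div (hf : DifferentiableAt ℝ f x) (hh : DifferentiableAt ℝ h x) (hx : h x ≠ 0) :
    pd μ (fun y => f y / h y) x = (pd μ f x * h x - f x * pd μ h x) / h x ^ 2 := by
  simpa only [pd, Function.update_eq_self] using
    ((hasDerivAt_pd μ hf).fun_div (hasDerivAt_pd μ hh)
      (by rwa [Function.update_eq_self])).deriv

theorem pd_sum {ι : Type*} (s : Finset ι) {F : ι → Coord → ℝ}
    (hF : ∀ i ∈ s, DifferentiableAt ℝ (F i) x) :
    pd μ (fun y => ∑ i ∈ s, F i y) x = ∑ i ∈ s, pd μ (F i) x :=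
  (HasDerivAt.fun_sum (x := x μ) fun i hi => hasDerivAt_pd μ (hF i hi)).deriv

theorem pd_comp_apply (μ ν : Fin 4) (φ : ℝ → ℝ) (x : Coord) :
    pd μ (fun y => φ (y ν)) x = if μ = ν then deriv φ (x ν) else 0 := by
  split_ifs with h
  · subst h
    simp [pd]
  · simp [pd, Function.update_of_ne (Ne.symm h)]

theorem pd_det {g : Metric} (hg : ∀ i j, DifferentiableAt ℝ (fun y => g y i j) x) (μ : Fin 4) :
    pd μ (fun y => (g y).det) x
      = ((g x).adjugate * Matrix.of fun i j => pd μ (fun y => g y i j) x).trace := by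
  have h := hasDerivAt_det (A := fun t => g (Function.update x μ t))
    (A' := Matrix.of fun i j => pd μ (fun y => g y i j) x) fun i j => hasDerivAt_pd μ (hg i j)
  rw [pd, h.deriv, Function.update_eq_self]

end PartialDerivatives

section Connection

variable {g : Metric} {x : Coord}

theorem christoffel_comm (hg : ∀ y, (g y).IsSymm) (l μ ν : Fin 4) (x : Coord) :
    christoffel g l μ ν x = christoffel g l ν μ x := by
  simp only [christoffel, fun y => (hg y).apply μ ν, add_comm (pd μ _ x)]

theorem isSymm_invMetric (hg : (g x).IsSymm) : (invMetric g x).IsSymm := by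
  rw [Matrix.IsSymm, invMetric, Matrix.transpose_nonsing_inv, hg.eq]

theorem christoffel_eq_of_lower (hdet : (g x).det ≠ 0) {μ ν : Fin 4} {C : Fin 4 → ℝ}
    (hC : ∀ k, ∑ l, g x k l * C l = 1 / 2 *
      (pd μ (fun y => g y k ν) x + pd ν (fun y => g y k μ) x - pd k (fun y => g y μ ν) x))
    (l : Fin 4) : christoffel g l μ ν x = C l := by
  have : Invertible (g x) := (g x).invertibleOfIsUnitDet hdet.isUnit
  have h := Matrix.inv_mulVec_eq_vec (funext fun k => (hC k).symm)
  rw [← h]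
  simp only [christoffel, invMetric, Matrix.mulVec, dotProduct, Finset.mul_sum]
  exact Finset.sum_congr rfl fun k _ => by ring

theorem sum_christoffel (hsymm : ∀ y, (g y).IsSymm)
    (hg : ∀ i j, DifferentiableAt ℝ (fun y => g y i j) x) (l : Fin 4) :
    ∑ μ, christoffel g μ μ l x = pd l (fun y => (g y).det) x / (2 * (g x).det) := by
  have hinv := isSymm_invMetric (hsymm x)
  have hcancel : ∑ μ, ∑ k, invMetric g x μ k * pd μ (fun y => g y k l) x
      = ∑ μ, ∑ k, invMetric g x μ k * pd k (fun y => g y μ l) x := by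
    rw [Finset.sum_comm]
    simp only [hinv.apply]
  have htrace : ∑ μ, christoffel g μ μ l x
      = 1 / 2 * ∑ μ, ∑ k, invMetric g x μ k * pd l (fun y => g y k μ) x := by
    simp only [christoffel, mul_sub, mul_add, ← Finset.mul_sum, Finset.sum_sub_distrib,
      Finset.sum_add_distrib, hcancel]
    ring
  rw [htrace, pd_det hg, invMetric, Matrix.inv_def, Ring.inverse_eq_inv']
  simp only [Matrix.trace, Matrix.diag, Matrix.mul_apply, Matrix.smul_apply, Matrix.of_apply,
    smul_eq_mul, mul_assoc, ← Finset.mul_sum]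
  ring

theorem divergence_single (g : Metric) (i : Fin 4) (x : Coord) :
    divergence g (fun _ => Pi.single i 1) x = ∑ μ, christoffel g μ μ i x := by
  simp only [divergence, covDeriv, pd_const, zero_add, Pi.single_apply, mul_ite, mul_one,
    mul_zero, Finset.sum_ite_eq', Finset.mem_univ, if_true]

theorem mulVec_current (hdet : (g x).det ≠ 0) (hg : (g x).IsSymm) (V : VField) :
    g x *ᵥ current g V x = (Matrix.of fun α β => einstein g α β x) *ᵥ V x := by
  have hunit := hdet.isUnit
  have hup : (Matrix.of fun μ ν => einsteinUp g μ ν x)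
      = invMetric g x * (Matrix.of fun α β => einstein g α β x) * invMetric g x := by
    ext μ ν
    simp only [einsteinUp, Matrix.mul_apply, Matrix.of_apply, Finset.sum_mul]
    rw [Finset.sum_comm]
    refine Finset.sum_congr rfl fun β _ => Finset.sum_congr rfl fun α _ => ?_
    rw [(isSymm_invMetric hg).apply ν β]
    ring
  have hcur : current g V x = (Matrix.of fun μ ν => einsteinUp g μ ν x) *ᵥ (g x *ᵥ V x) := rfl
  rw [hcur, hup, invMetric, Matrix.mulVec_mulVec, Matrix.mulVec_mulVec, mul_assoc, mul_assoc,
    mul_assoc, Matrix.mul_nonsing_inv_cancel_left _ _ hunit, Matrix.nonsing_inv_mul _ hunit,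
    mul_one]

theorem scalarCurv_eq_zero_of_ricci_eq (hdet : (g x).det ≠ 0)
    (hg : (g x).IsSymm) {V k n : Fin 4 → ℝ} (hV : g x *ᵥ V = k) (hn : V ⬝ᵥ n = 0)
    (hric : ∀ μ ν, ricci g μ ν x = k μ * n ν + n μ * k ν) : scalarCurv g x = 0 := by
  have : Invertible (g x) := (g x).invertibleOfIsUnitDet hdet.isUnit
  have hraise : invMetric g x *ᵥ k = V := Matrix.inv_mulVec_eq_vec hV.symm
  have hnk : n ⬝ᵥ (invMetric g x *ᵥ k) = 0 := by rw [hraise, dotProduct_comm, hn]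
  have hkn : k ⬝ᵥ (invMetric g x *ᵥ n) = 0 := by
    rw [Matrix.dotProduct_mulVec, ← Matrix.mulVec_transpose, (isSymm_invMetric hg).eq, hraise, hn]
  calc scalarCurv g x = k ⬝ᵥ (invMetric g x *ᵥ n) + n ⬝ᵥ (invMetric g x *ᵥ k) := by
        simp only [scalarCurv, hric, dotProduct, Matrix.mulVec, Finset.mul_sum,
          ← Finset.sum_add_distrib]
        exact Finset.sum_congr rfl fun μ _ => Finset.sum_congr rfl fun ν _ => by ring
    _ = 0 := by rw [hkn, hnk, add_zero]

end Connection

section VolumeDensity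

/-- `D` is a volume density `√(-det g)` of the Lorentzian metric `g` on the open set `U`, up to a
sign. Naming a root `D` instead of taking `√(-det g)` makes `D` available in closed form. -/
structure IsVolumeDensityOn (D : Coord → ℝ) (g : Metric) (U : Set Coord) : Prop where
  isOpen : IsOpen U
  isSymm : ∀ x, (g x).IsSymm
  differentiableAt_metric : ∀ x ∈ U, ∀ i j, DifferentiableAt ℝ (fun y => g y i j) x
  differentiableAt : ∀ x ∈ U, DifferentiableAt ℝ D x
  ne_zero : ∀ x ∈ U, D x ≠ 0
  det_eq : ∀ x ∈ U, (g x).det = -D x ^ 2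

namespace IsVolumeDensityOn

variable {g : Metric} {x : Coord} {D : Coord → ℝ} {U : Set Coord}
variable (h : IsVolumeDensityOn D g U) (hx : x ∈ U)
include h hx

theorem det_ne_zero : (g x).det ≠ 0 := by
  simpa only [h.det_eq x hx, neg_ne_zero] using pow_ne_zero 2 (h.ne_zero x hx)

theorem sum_christoffel (l : Fin 4) : ∑ μ, christoffel g μ μ l x = pd l D x / D x := by
  have hdet : (fun y => (g y).det) =ᶠ[𝓝 x] fun y => -D y ^ 2 :=
    eventually_of_mem (h.isOpen.mem_nhds hx) h.det_eq
  have hD := h.ne_zero x hx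
  rw [KerrVaidya.sum_christoffel h.isSymm (h.differentiableAt_metric x hx), pd_congr l hdet,
    pd_neg, pd_pow (h.differentiableAt x hx), h.det_eq x hx]
  norm_num
  field_simp

/-- The Voss–Weyl formula. -/
theorem mul_divergence {V : VField} (hV : ∀ μ, DifferentiableAt ℝ (fun y => V y μ) x) :
    D x * divergence g V x = ∑ μ, pd μ (fun y => D y * V y μ) x := by
  have hD := h.ne_zero x hx
  have hpd (μ : Fin 4) := pd_mul (μ := μ) (h.differentiableAt x hx) (hV μ)
  simp only [divergence, covDeriv, Finset.sum_add_distrib, hpd]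
  rw [Finset.sum_comm (f := fun μ l => christoffel g μ μ l x * V x l)]
  simp only [← Finset.sum_mul, h.sum_christoffel hx, mul_add, Finset.mul_sum]
  rw [add_comm]
  congr 1
  exact Finset.sum_congr rfl fun μ _ => by field_simp

theorem ricci_eq (hΓ : ∀ p μ, DifferentiableAt ℝ (christoffel g p p μ) x) (μ ν : Fin 4) :
    ricci g μ ν x = ∑ p, pd p (christoffel g p μ ν) x - pd ν (fun y => pd μ D y / D y) x
      + ∑ l, pd l D x / D x * christoffel g l μ ν x
      - ∑ p, ∑ l, christoffel g p ν l x * christoffel g l μ p x := by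
  have htrace : (fun y => ∑ p, christoffel g p p μ y) =ᶠ[𝓝 x] fun y => pd μ D y / D y :=
    eventually_of_mem (h.isOpen.mem_nhds hx) fun y hy => h.sum_christoffel hy μ
  rw [← pd_congr ν htrace, pd_sum _ fun p _ => hΓ p μ]
  simp only [ricci, riemann, Finset.sum_add_distrib, Finset.sum_sub_distrib,
    ← h.sum_christoffel hx, Finset.sum_mul, funext (christoffel_comm h.isSymm _ ν μ),
    christoffel_comm h.isSymm _ _ μ]
  rw [Finset.sum_comm (f := fun p l => christoffel g p p l x * christoffel g l μ ν x)]
  ring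

end IsVolumeDensityOn

end VolumeDensity

section Coordinates

theorem pd_apply (μ ν : Fin 4) (x : Coord) :
    pd μ (fun y => y ν) x = if μ = ν then 1 else 0 := by
  simpa only [id, deriv_id] using pd_comp_apply μ ν id x

theorem pd_sin (μ ν : Fin 4) (x : Coord) :
    pd μ (fun y => Real.sin (y ν)) x = if μ = ν then Real.cos (x ν) else 0 := by
  rw [pd_comp_apply μ ν Real.sin, Real.deriv_sin]

theorem pd_cos (μ ν : Fin 4) (x : Coord) :
    pd μ (fun y => Real.cos (y ν)) x = if μ = ν then -Real.sin (x ν) else 0 := by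
  rw [pd_comp_apply μ ν Real.cos, Real.deriv_cos]

variable {x : Coord}

theorem isOpen_domain : IsOpen domain := by
  have h (i : Fin 4) : Continuous fun x : Coord => x i := continuous_apply i
  exact (isOpen_lt continuous_const (h 1)).inter
    ((isOpen_lt continuous_const (h 2)).inter (isOpen_lt (h 2) continuous_const))

theorem sin_pos_of_mem_domain (hx : x ∈ domain) : 0 < Real.sin (x 2) :=
  Real.sin_pos_of_pos_of_lt_pi hx.2.1 hx.2.2

theorem rhoSq_pos (a : ℝ) (hx : x ∈ domain) : 0 < rhoSq a x := by
  have := hx.1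
  unfold rhoSq
  positivity

theorem rhoSq_eq_sub_sin_sq (a : ℝ) (x : Coord) :
    rhoSq a x = x 1 ^ 2 + a ^ 2 * (1 - Real.sin (x 2) ^ 2) := by
  rw [rhoSq, Real.cos_sq']

@[fun_prop]
theorem differentiable_rhoSq (a : ℝ) : Differentiable ℝ (rhoSq a) := by
  unfold rhoSq
  fun_prop

theorem pd_rhoSq (a : ℝ) (μ : Fin 4) (x : Coord) :
    pd μ (rhoSq a) x =
      ![0, 2 * x 1, -(2 * a ^ 2 * Real.cos (x 2) * Real.sin (x 2)), 0] μ := by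
  unfold rhoSq
  rw [pd_add (by fun_prop) (by fun_prop), pd_mul (by fun_prop) (by fun_prop),
    pd_const μ (a ^ 2), pd_pow (by fun_prop), pd_pow (by fun_prop), pd_apply, pd_cos]
  fin_cases μ <;> simp
  ring

end Coordinates

section KerrSchild

/-- The scalar `F = 2Mr/ρ²` of the Kerr–Schild form `g = η + F l ⊗ l` of the metric. -/
def kerrSchild (a : ℝ) (M : ℝ → ℝ) (x : Coord) : ℝ := 2 * M (x 0) * x 1 / rhoSq a x

/-- The background `η` of the Kerr–Schild form: the Minkowski metric in ingoing spheroidal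
coordinates. -/
def flatMetric (a : ℝ) : Metric := fun x =>
  !![-1, 1, 0, 0;
     1, 0, 0, -(a * Real.sin (x 2) ^ 2);
     0, 0, rhoSq a x, 0;
     0, -(a * Real.sin (x 2) ^ 2), 0, Gam a x * Real.sin (x 2) ^ 2]

/-- The null covector `l = dv - a sin²ϑ dψ` of the Kerr–Schild form; it is dual to `∂/∂r`. -/
def nullCovector (a : ℝ) (x : Coord) : Fin 4 → ℝ := ![1, 0, 0, -(a * Real.sin (x 2) ^ 2)]

/-- The partial derivatives of `kerrSchild`, written in terms of `F` itself. -/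
def kerrSchildDeriv (a : ℝ) (M : ℝ → ℝ) (x : Coord) : Fin 4 → ℝ :=
  ![2 * x 1 * deriv M (x 0) / rhoSq a x,
    2 * (M (x 0) - x 1 * kerrSchild a M x) / rhoSq a x,
    2 * a ^ 2 * Real.cos (x 2) * Real.sin (x 2) * kerrSchild a M x / rhoSq a x,
    0]

/-- The second partial derivatives of `kerrSchild`, written in terms of `F` and its first
derivatives. -/
def kerrSchildHess (a : ℝ) (M : ℝ → ℝ) (x : Coord) : Matrix (Fin 4) (Fin 4) ℝ :=
  let r := x 1
  let c := Real.cos (x 2)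
  let s := Real.sin (x 2)
  let ρ2 := rhoSq a x
  let F := kerrSchild a M x
  let dF := kerrSchildDeriv a M x
  let vr := 2 * (deriv M (x 0) - r * dF 0) / ρ2
  let vθ := 2 * a ^ 2 * c * s * dF 0 / ρ2
  let rθ := 2 * a ^ 2 * c * s * (dF 1 - 2 * r * F / ρ2) / ρ2
  let θθ := 2 * a ^ 2 * ((c ^ 2 - s ^ 2) * F + c * s * dF 2) / ρ2
    + 4 * a ^ 4 * c ^ 2 * s ^ 2 * F / ρ2 ^ 2
  !![2 * r * deriv (deriv M) (x 0) / ρ2, vr, vθ, 0;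
     vr, -2 * (F + 2 * r * dF 1) / ρ2, rθ, 0;
     vθ, rθ, θθ, 0;
     0, 0, 0, 0]

/-- The partial derivatives of the components of `flatMetric`, first index differentiating. -/
def flatMetricDeriv (a : ℝ) (x : Coord) : Fin 4 → Matrix (Fin 4) (Fin 4) ℝ
  | 1 => !![0, 0, 0, 0; 0, 0, 0, 0; 0, 0, 2 * x 1, 0; 0, 0, 0, 2 * x 1 * Real.sin (x 2) ^ 2]
  | 2 => (2 * Real.cos (x 2) * Real.sin (x 2)) •
      !![0, 0, 0, 0; 0, 0, 0, -a; 0, 0, -a ^ 2, 0; 0, -a, 0, Gam a x]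
  | _ => 0

variable {a : ℝ} {M : ℝ → ℝ} {x : Coord}

theorem metric_eq_kerrSchild (a : ℝ) (M : ℝ → ℝ) (hx : x ∈ domain) :
    metric a M x = flatMetric a x
      + kerrSchild a M x • Matrix.vecMulVec (nullCovector a x) (nullCovector a x) := by
  have hρ := (rhoSq_pos a hx).ne'
  have hΓ : Gam a x = rhoSq a x + a ^ 2 * Real.sin (x 2) ^ 2 := by
    rw [Gam, rhoSq_eq_sub_sin_sq]
    ring
  have hΔ : Delta a M x = Gam a x - 2 * M (x 0) * x 1 := by
    rw [Delta, Gam]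
    ring
  ext i j
  fin_cases i <;> fin_cases j <;>
    simp only [metric, kerrSchild, flatMetric, nullCovector, hΔ, hΓ, Fin.zero_eta, Fin.mk_one,
      Fin.reduceFinMk, Matrix.add_apply, Matrix.smul_apply, Matrix.vecMulVec_apply, smul_eq_mul,
      Matrix.of_apply, Matrix.cons_val] <;>
    field_simp <;> ring

theorem metric_apply (a : ℝ) (M : ℝ → ℝ) (hx : x ∈ domain) (i j : Fin 4) :
    metric a M x i j = flatMetric a x i j
      + kerrSchild a M x * (nullCovector a x i * nullCovector a x j) := by
  simp only [metric_eq_kerrSchild a M hx, Matrix.add_apply, Matrix.smul_apply,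
    Matrix.vecMulVec_apply, smul_eq_mul]

theorem isSymm_metric (a : ℝ) (M : ℝ → ℝ) (x : Coord) : (metric a M x).IsSymm := by
  ext i j
  fin_cases i <;> fin_cases j <;> rfl

theorem metric_mulVec_single_one (a : ℝ) (M : ℝ → ℝ) (x : Coord) :
    metric a M x *ᵥ Pi.single 1 1 = nullCovector a x := by
  rw [Matrix.mulVec_single_one]
  ext i
  fin_cases i <;> rfl

theorem differentiableAt_kerrSchild (hM : Differentiable ℝ M) (hx : x ∈ domain) :
    DifferentiableAt ℝ (kerrSchild a M) x := by
  have hρ := (rhoSq_pos a hx).ne'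
  unfold kerrSchild
  fun_prop (disch := assumption)

theorem pd_kerrSchild (hM : Differentiable ℝ M) (hx : x ∈ domain) (μ : Fin 4) :
    pd μ (kerrSchild a M) x = kerrSchildDeriv a M x μ := by
  have hρ := (rhoSq_pos a hx).ne'
  unfold kerrSchild
  rw [pd_div (by fun_prop) (by fun_prop) hρ, pd_rhoSq, pd_mul (by fun_prop) (by fun_prop),
    pd_mul (by fun_prop) (by fun_prop), pd_comp_apply, pd_apply, pd_const]
  fin_cases μ <;>
    simp only [kerrSchildDeriv, kerrSchild, Fin.zero_eta, Fin.mk_one, Fin.reduceFinMk,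
      Matrix.cons_val, Fin.reduceEq, reduceIte] <;>
    field_simp <;> ring

theorem differentiableAt_kerrSchildDeriv (hM : Differentiable ℝ M)
    (hM' : Differentiable ℝ (deriv M)) (hx : x ∈ domain) (μ : Fin 4) :
    DifferentiableAt ℝ (fun y => kerrSchildDeriv a M y μ) x := by
  have hρ := (rhoSq_pos a hx).ne'
  have hF := differentiableAt_kerrSchild (a := a) hM hx
  fin_cases μ <;>
    simp only [kerrSchildDeriv, Fin.zero_eta, Fin.mk_one, Fin.reduceFinMk, Matrix.cons_val] <;>
    fun_prop (disch := assumption)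

theorem pd_kerrSchildDeriv (hM : Differentiable ℝ M) (hM' : Differentiable ℝ (deriv M))
    (hx : x ∈ domain) (μ ν : Fin 4) :
    pd μ (fun y => kerrSchildDeriv a M y ν) x = kerrSchildHess a M x μ ν := by
  have hρ := (rhoSq_pos a hx).ne'
  have hF := differentiableAt_kerrSchild (a := a) hM hx
  fin_cases ν <;>
    simp (disch := first | assumption | fun_prop) only [kerrSchildDeriv, Fin.zero_eta,
      Fin.mk_one, Fin.reduceFinMk, Matrix.cons_val, pd_div, pd_mul, pd_sub, pd_const, pd_apply,
      pd_rhoSq, pd_kerrSchild hM hx, pd_sin, pd_cos, pd_comp_apply _ 0 M,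
      pd_comp_apply _ 0 (deriv M)] <;>
    fin_cases μ <;>
    simp only [kerrSchildHess, kerrSchildDeriv, kerrSchild, Fin.zero_eta, Fin.mk_one,
      Fin.reduceFinMk, Matrix.of_apply, Matrix.cons_val, Fin.reduceEq, reduceIte, mul_zero,
      zero_mul, add_zero, zero_add, sub_zero, zero_sub, zero_div] <;>
    field_simp <;> ring

theorem differentiableAt_nullCovector (a : ℝ) (x : Coord) (i : Fin 4) :
    DifferentiableAt ℝ (fun y => nullCovector a y i) x := by
  fin_cases i <;>
    simp only [nullCovector, Fin.zero_eta, Fin.mk_one, Fin.reduceFinMk, Matrix.cons_val] <;>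
    fun_prop

theorem pd_nullCovector (a : ℝ) (x : Coord) (μ i : Fin 4) :
    pd μ (fun y => nullCovector a y i) x =
      if μ = 2 ∧ i = 3 then -(2 * a * Real.cos (x 2) * Real.sin (x 2)) else 0 := by
  fin_cases i
  · exact (pd_const μ 1 x).trans (by simp)
  · exact (pd_const μ 0 x).trans (by simp)
  · exact (pd_const μ 0 x).trans (by simp)
  · change pd μ (fun y => -(a * Real.sin (y 2) ^ 2)) x = _
    rw [pd_neg, pd_mul (by fun_prop) (by fun_prop), pd_pow (by fun_prop), pd_sin, pd_const]
    fin_cases μ <;> simp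
    ring

theorem differentiableAt_flatMetric (a : ℝ) (x : Coord) (i j : Fin 4) :
    DifferentiableAt ℝ (fun y => flatMetric a y i j) x := by
  fin_cases i <;> fin_cases j <;>
    simp only [flatMetric, Gam, Fin.zero_eta, Fin.mk_one, Fin.reduceFinMk, Matrix.of_apply,
      Matrix.cons_val] <;>
    fun_prop

theorem pd_flatMetric (a : ℝ) (x : Coord) (μ i j : Fin 4) :
    pd μ (fun y => flatMetric a y i j) x = flatMetricDeriv a x μ i j := by
  fin_cases i <;> fin_cases j <;>
    simp (disch := fun_prop) only [flatMetric, Gam, Fin.zero_eta, Fin.mk_one, Fin.reduceFinMk,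
      Matrix.of_apply, Matrix.cons_val, pd_add, pd_mul, pd_pow, pd_neg, pd_const, pd_apply,
      pd_rhoSq, pd_sin] <;>
    fin_cases μ <;>
    simp only [flatMetricDeriv, Gam, Fin.zero_eta, Fin.mk_one, Fin.reduceFinMk,
      Matrix.smul_apply, smul_eq_mul, Matrix.zero_apply, Matrix.of_apply, Matrix.cons_val,
      Fin.reduceEq, reduceIte, Nat.cast_ofNat, Nat.reduceSub] <;>
    ring

theorem metric_eventuallyEq (a : ℝ) (M : ℝ → ℝ) (hx : x ∈ domain) (i j : Fin 4) :
    (fun y => metric a M y i j) =ᶠ[𝓝 x] fun y => flatMetric a y i j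
      + kerrSchild a M y * (nullCovector a y i * nullCovector a y j) :=
  eventually_of_mem (isOpen_domain.mem_nhds hx) fun _ hy => metric_apply a M hy i j

theorem differentiableAt_metric (hM : Differentiable ℝ M) (hx : x ∈ domain) (i j : Fin 4) :
    DifferentiableAt ℝ (fun y => metric a M y i j) x :=
  have hl := differentiableAt_nullCovector a x
  ((differentiableAt_flatMetric a x i j).add
    ((differentiableAt_kerrSchild hM hx).mul ((hl i).mul (hl j)))).congr_of_eventuallyEq
      (metric_eventuallyEq a M hx i j)

theorem pd_metric (hM : Differentiable ℝ M) (hx : x ∈ domain) (μ i j : Fin 4) :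
    pd μ (fun y => metric a M y i j) x = flatMetricDeriv a x μ i j
      + (kerrSchildDeriv a M x μ * (nullCovector a x i * nullCovector a x j)
        + kerrSchild a M x * (pd μ (fun y => nullCovector a y i) x * nullCovector a x j
          + nullCovector a x i * pd μ (fun y => nullCovector a y j) x)) := by
  have hl := differentiableAt_nullCovector a x
  have hF := differentiableAt_kerrSchild (a := a) hM hx
  have hll := (hl i).fun_mul (hl j)
  rw [pd_congr μ (metric_eventuallyEq a M hx i j),
    pd_add (differentiableAt_flatMetric a x i j) (hF.fun_mul hll), pd_mul hF hll,
    pd_mul (hl i) (hl j), pd_flatMetric, pd_kerrSchild hM hx]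

end KerrSchild

section Connection

/-- The Christoffel symbols of `metric a M` in closed form, upper index first. -/
def connection (a : ℝ) (M : ℝ → ℝ) (x : Coord) : Fin 4 → Matrix (Fin 4) (Fin 4) ℝ :=
  let r := x 1
  let c := Real.cos (x 2)
  let s := Real.sin (x 2)
  let k := c / s
  let w := 1 / rhoSq a x
  let γ := r ^ 2 + a ^ 2
  let t := a * s ^ 2
  let F := kerrSchild a M x
  let δ := γ - rhoSq a x * F
  let h := 1 / 2 * kerrSchildDeriv a M x 0
  let b := -(1 / 2 * kerrSchildDeriv a M x 1)
  let q := 1 / 2 * kerrSchildDeriv a M x 2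
  let g₀ := γ * w * b - h * a * t * w
  let g₁ := δ * w * b - h * a * t * w
  let g₃ := a * w * b - h * a * w
  let e := a ^ 2 * c * s * w
  let p := a * c * s * γ * w ^ 2 * F
  let z := c * s * w * (γ + F * a * t * (γ * w + 1))
  let u := a * F * w * k
  fun
  | 0 => !![g₀, 0, -q, -(t * g₀);
       0, 0, -e, r * t * w;
       -q, -e, -(r * γ * w), t * q;
       -(t * g₀), r * t * w, t * q, t ^ 2 * g₀ - r * s ^ 2 * γ * w]
  | 1 => !![g₁ + h, -b, 0, -(t * g₁);
       -b, 0, -e, t * (b + r * w);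
       0, -e, -(r * δ * w), 0;
       -(t * g₁), t * (b + r * w), 0, t ^ 2 * (g₁ - h) - r * s ^ 2 * δ * w]
  | 2 => !![-(w * q), 0, 0, p;
       0, 0, r * w, a * c * s * w;
       0, r * w, -e, 0;
       p, a * c * s * w, 0, -z]
  | 3 => !![g₃, 0, -u, -(t * g₃);
       0, 0, -(a * w * k), r * w;
       -u, -(a * w * k), -(r * a * w), k + q;
       -(t * g₃), r * w, k + q, t ^ 2 * g₃ - t * r * w]

/-- The volume density `ρ² sin ϑ` of the Kerr-Vaidya metric. -/
def volumeDensity (a : ℝ) (x : Coord) : ℝ := rhoSq a x * Real.sin (x 2)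

/-- The partial derivatives of the logarithm of `volumeDensity`. -/
def logVolumeDeriv (a : ℝ) (x : Coord) : Fin 4 → ℝ :=
  let c := Real.cos (x 2)
  let s := Real.sin (x 2)
  ![0, 2 * x 1 / rhoSq a x, c / s - 2 * a ^ 2 * c * s / rhoSq a x, 0]

/-- The second partial derivatives of the logarithm of `volumeDensity`. -/
def logVolumeHess (a : ℝ) (x : Coord) : Matrix (Fin 4) (Fin 4) ℝ :=
  let r := x 1
  let c := Real.cos (x 2)
  let s := Real.sin (x 2)
  let ρ2 := rhoSq a x
  let rθ := 4 * a ^ 2 * r * c * s / ρ2 ^ 2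
  let θθ := -(1 + c ^ 2 / s ^ 2) - 2 * a ^ 2 * (c ^ 2 - s ^ 2) / ρ2
    - (2 * a ^ 2 * c * s) ^ 2 / ρ2 ^ 2
  !![0, 0, 0, 0;
     0, 2 / ρ2 - 4 * r ^ 2 / ρ2 ^ 2, rθ, 0;
     0, rθ, θθ, 0;
     0, 0, 0, 0]

variable {a : ℝ} {M : ℝ → ℝ} {x : Coord}

theorem isVolumeDensityOn_metric (a : ℝ) (hM : Differentiable ℝ M) :
    IsVolumeDensityOn (volumeDensity a) (metric a M) domain where
  isOpen := isOpen_domain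
  isSymm := isSymm_metric a M
  differentiableAt_metric _ hx := differentiableAt_metric hM hx
  differentiableAt _ _ := by
    unfold volumeDensity
    fun_prop
  ne_zero _ hx := (mul_pos (rhoSq_pos a hx) (sin_pos_of_mem_domain hx)).ne'
  det_eq := det_metric a M

theorem pd_volumeDensity_div (hx : x ∈ domain) (μ : Fin 4) :
    pd μ (volumeDensity a) x / volumeDensity a x = logVolumeDeriv a x μ := by
  have hρ := (rhoSq_pos a hx).ne'
  have hs := (sin_pos_of_mem_domain hx).ne'
  unfold volumeDensity
  rw [pd_mul (by fun_prop) (by fun_prop), pd_rhoSq, pd_sin]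
  fin_cases μ <;>
    simp only [logVolumeDeriv, Fin.zero_eta, Fin.mk_one, Fin.reduceFinMk, Matrix.cons_val,
      Fin.reduceEq, reduceIte] <;>
    field_simp <;> ring

theorem pd_logVolumeDeriv (hx : x ∈ domain) (μ ν : Fin 4) :
    pd μ (fun y => logVolumeDeriv a y ν) x = logVolumeHess a x μ ν := by
  have hρ := (rhoSq_pos a hx).ne'
  have hs := (sin_pos_of_mem_domain hx).ne'
  fin_cases ν <;>
    simp (disch := first | assumption | fun_prop (disch := assumption)) only [logVolumeDeriv,
      Fin.zero_eta, Fin.mk_one, Fin.reduceFinMk, Matrix.cons_val, pd_div, pd_mul, pd_sub,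
      pd_const, pd_apply, pd_rhoSq, pd_sin, pd_cos] <;>
    fin_cases μ <;>
    simp only [logVolumeHess, Fin.zero_eta, Fin.mk_one, Fin.reduceFinMk, Matrix.of_apply,
      Matrix.cons_val, Fin.reduceEq, reduceIte] <;>
    field_simp <;> ring

set_option maxHeartbeats 1000000 in
theorem christoffel_metric (hM : Differentiable ℝ M) (hx : x ∈ domain) (l μ ν : Fin 4) :
    christoffel (metric a M) l μ ν x = connection a M x l μ ν := by
  have hρ := (rhoSq_pos a hx).ne'
  have hs := (sin_pos_of_mem_domain hx).ne'
  have hρ_eq := rhoSq_eq_sub_sin_sq a x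
  refine christoffel_eq_of_lower (C := fun l => connection a M x l μ ν)
    (isVolumeDensityOn_metric a hM |>.det_ne_zero hx) (fun k => ?_) l
  simp only [pd_metric hM hx, metric_apply a M hx, pd_nullCovector, Fin.sum_univ_four, connection,
    flatMetric]
  simp only [nullCovector, Gam]
  clear l hx hM
  have hθ : kerrSchildDeriv a M x 2 =
    2 * a ^ 2 * Real.cos (x 2) * Real.sin (x 2) * kerrSchild a M x / rhoSq a x := rfl
  have hψ : kerrSchildDeriv a M x 3 = 0 := rfl
  generalize kerrSchildDeriv a M x = dF at *
  generalize kerrSchild a M x = F at *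
  rw [hρ_eq] at hρ hθ
  simp only [hρ_eq]
  clear hρ_eq
  generalize hD : flatMetricDeriv a x = D
  fin_cases μ <;> fin_cases ν <;>
    simp only [Fin.zero_eta, Fin.mk_one, Fin.reduceFinMk, Matrix.of_apply, Matrix.cons_val,
      Fin.reduceEq, false_and, true_and, reduceIte, mul_zero, add_zero, zero_add] <;>
    fin_cases k <;>
    simp only [← hD, flatMetricDeriv, hθ, hψ, Gam, Fin.zero_eta, Fin.mk_one, Fin.reduceFinMk,
      Matrix.smul_apply, smul_eq_mul, Matrix.zero_apply, Matrix.of_apply, Matrix.cons_val,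
      Fin.reduceEq, reduceIte, and_true, and_false, mul_zero, zero_mul, add_zero, zero_add] <;>
    field_simp <;> ring

theorem christoffel_metric_eventuallyEq (hM : Differentiable ℝ M) (hx : x ∈ domain)
    (l μ ν : Fin 4) :
    christoffel (metric a M) l μ ν =ᶠ[𝓝 x] fun y => connection a M y l μ ν :=
  eventually_of_mem (isOpen_domain.mem_nhds hx) fun _ hy => christoffel_metric hM hy l μ ν

theorem differentiableAt_connection (hM : Differentiable ℝ M) (hM' : Differentiable ℝ (deriv M))
    (hx : x ∈ domain) (l μ ν : Fin 4) :
    DifferentiableAt ℝ (fun y => connection a M y l μ ν) x := by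
  have hρ := (rhoSq_pos a hx).ne'
  have hs := (sin_pos_of_mem_domain hx).ne'
  have hF := differentiableAt_kerrSchild (a := a) hM hx
  have hdF := differentiableAt_kerrSchildDeriv (a := a) hM hM' hx
  fin_cases l <;> fin_cases μ <;> fin_cases ν <;>
    simp only [connection, Fin.zero_eta, Fin.mk_one, Fin.reduceFinMk, Matrix.of_apply,
      Matrix.cons_val] <;>
    fun_prop (disch := assumption)

end Connection

section Curvature

variable {a : ℝ} {M : ℝ → ℝ} {x : Coord}

/-- The covector `n` such that the Ricci tensor of `metric a M` has the null-fluid form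
`l ⊗ n + n ⊗ l`, where `l` is `nullCovector a`. -/
def energyFlux (a : ℝ) (M : ℝ → ℝ) (x : Coord) : Fin 4 → ℝ :=
  let r := x 1
  let c := Real.cos (x 2)
  let s := Real.sin (x 2)
  let ρ2 := rhoSq a x
  let M' := deriv M (x 0)
  let M'' := deriv (deriv M) (x 0)
  let e := (r ^ 2 - a ^ 2 * c ^ 2) * M' / ρ2 ^ 2
  let j := r ^ 2 * M' / ρ2 ^ 2 + a ^ 2 * s ^ 2 * e / ρ2 - r * a ^ 2 * s ^ 2 * M'' / (2 * ρ2 ^ 2)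
  ![j, 0, -(2 * r * a ^ 2 * c * s * M' / ρ2 ^ 2), -(a * s ^ 2 * (j + e))]

theorem ricci_metric_eq (hM : Differentiable ℝ M) (hM' : Differentiable ℝ (deriv M))
    (hx : x ∈ domain) (μ ν : Fin 4) :
    ricci (metric a M) μ ν x = ∑ p, pd p (fun y => connection a M y p μ ν) x
      - logVolumeHess a x ν μ
      + ∑ l, logVolumeDeriv a x l * connection a M x l μ ν
      - ∑ p, ∑ l, connection a M x p ν l * connection a M x l μ p := by
  have hΓ := christoffel_metric_eventuallyEq (a := a) hM hx
  rw [(isVolumeDensityOn_metric a hM).ricci_eq hx fun p μ =>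
    (differentiableAt_connection hM hM' hx p p μ).congr_of_eventuallyEq (hΓ p p μ),
    pd_congr ν (eventually_of_mem (isOpen_domain.mem_nhds hx) fun y hy =>
      pd_volumeDensity_div hy μ), pd_logVolumeDeriv hx]
  simp only [pd_volumeDensity_div hx, christoffel_metric hM hx, pd_congr _ (hΓ _ _ _)]

set_option maxHeartbeats 2500000 in
theorem ricci_metric (hM : Differentiable ℝ M) (hM' : Differentiable ℝ (deriv M))
    (hx : x ∈ domain) (μ ν : Fin 4) :
    ricci (metric a M) μ ν x =
      nullCovector a x μ * energyFlux a M x ν + energyFlux a M x μ * nullCovector a x ν := by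
  have hρ := (rhoSq_pos a hx).ne'
  have hs := (sin_pos_of_mem_domain hx).ne'
  have hF := differentiableAt_kerrSchild (a := a) hM hx
  have hdF := differentiableAt_kerrSchildDeriv (a := a) hM hM' hx
  have pd_F := pd_kerrSchild (a := a) hM hx
  have pd_dF := pd_kerrSchildDeriv (a := a) hM hM' hx
  have hρ_eq := rhoSq_eq_sub_sin_sq a x
  have hc2 := Real.cos_sq' (x 2)
  rw [ricci_metric_eq hM hM' hx]
  simp only [Fin.sum_univ_four]
  fin_cases μ <;> fin_cases ν <;>
    simp (disch := first | assumption | fun_prop (disch := assumption)) only [connection,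
      Fin.zero_eta, Fin.mk_one, Fin.reduceFinMk, Fin.isValue, Matrix.of_apply, Matrix.cons_val,
      pd_div, pd_mul, pd_pow, pd_sub, pd_add, pd_neg, pd_const, pd_apply, pd_rhoSq, pd_sin,
      pd_cos, pd_F, pd_dF] <;>
    simp only [logVolumeHess, logVolumeDeriv, energyFlux, nullCovector, kerrSchildHess,
      kerrSchildDeriv, kerrSchild, Matrix.of_apply, Matrix.cons_val, Fin.reduceEq, reduceIte,
      Nat.cast_ofNat, Nat.reduceSub, pow_one, mul_zero, zero_mul, add_zero, zero_add, sub_zero,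
      zero_sub, neg_zero, zero_div] <;>
    field_simp <;> rw [hρ_eq] <;> ring_nf <;> simp only [hc2] <;> ring

end Curvature

section Kodama

variable {a : ℝ} {M : ℝ → ℝ} {x : Coord}

theorem divergence_K (hM : Differentiable ℝ M) (hx : x ∈ domain) :
    divergence (metric a M) K x = 0 := by
  have h := isVolumeDensityOn_metric a hM
  exact (divergence_single _ 0 x).trans <| (h.sum_christoffel hx 0).trans <|
    pd_volumeDensity_div hx 0

theorem along_K (f : Coord → ℝ) (x : Coord) : along K f x = pd 0 f x := by
  simp only [along, K, Pi.single_apply, ite_mul, one_mul, zero_mul, Finset.sum_ite_eq',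
    Finset.mem_univ, if_true]

theorem normSq_K (a : ℝ) (M : ℝ → ℝ) (x : Coord) :
    normSq (metric a M) K x = 2 * M (x 0) * x 1 / rhoSq a x - 1 := by
  simp [normSq, K, metric, Pi.single_apply]

theorem normSq_K_neg_iff (a : ℝ) (M : ℝ → ℝ) (hx : x ∈ domain) :
    normSq (metric a M) K x < 0 ↔ 2 * M (x 0) * x 1 < rhoSq a x := by
  rw [normSq_K, sub_neg, div_lt_one (rhoSq_pos a hx)]

theorem scalarCurv_metric (hM : Differentiable ℝ M) (hM' : Differentiable ℝ (deriv M))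
    (hx : x ∈ domain) : scalarCurv (metric a M) x = 0 :=
  scalarCurv_eq_zero_of_ricci_eq ((isVolumeDensityOn_metric a hM).det_ne_zero hx)
    (isSymm_metric a M x) (metric_mulVec_single_one a M x)
    (single_one_dotProduct 1 (energyFlux a M x)) (ricci_metric hM hM' hx)

/-- The Kodama-like current `J^a = G^{ab} K_b` of the Kerr-Vaidya metric in closed form. -/
def kodamaCurrent (a : ℝ) (M : ℝ → ℝ) : VField := fun x =>
  ![1 / rhoSq a x ^ 3 * (a ^ 2 * Real.sin (x 2) ^ 2 *
      (a ^ 2 * Real.cos (x 2) ^ 2 - x 1 ^ 2) * deriv M (x 0)),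
    1 / rhoSq a x ^ 3 *
      ((rhoSq a x ^ 2 + x 1 ^ 4 + x 1 ^ 2 * a ^ 2 * Real.sin (x 2) ^ 2
          - a ^ 4 * Real.cos (x 2) ^ 2) * deriv M (x 0)
        - x 1 * rhoSq a x * a ^ 2 * Real.sin (x 2) ^ 2 * deriv (deriv M) (x 0)),
    -(1 / rhoSq a x ^ 3 * (x 1 * a ^ 2 * Real.sin (2 * x 2) * deriv M (x 0))),
    1 / rhoSq a x ^ 3 * (a * (a ^ 2 * Real.cos (x 2) ^ 2 - x 1 ^ 2) * deriv M (x 0))]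

theorem nullCovector_dotProduct_kodamaCurrent (a : ℝ) (M : ℝ → ℝ) (x : Coord) :
    nullCovector a x ⬝ᵥ kodamaCurrent a M x = 0 := by
  simp only [nullCovector, kodamaCurrent, dotProduct, Fin.sum_univ_four, Matrix.cons_val]
  ring

theorem flatMetric_mulVec_kodamaCurrent (M : ℝ → ℝ) (hx : x ∈ domain) :
    flatMetric a x *ᵥ kodamaCurrent a M x =
      energyFlux a M x 0 • nullCovector a x + energyFlux a M x := by
  have hρ := (rhoSq_pos a hx).ne'
  have hρ_eq := rhoSq_eq_sub_sin_sq a x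
  ext i
  fin_cases i <;>
    simp only [flatMetric, kodamaCurrent, energyFlux, nullCovector, Matrix.mulVec, dotProduct,
      Fin.sum_univ_four, Real.sin_two_mul, Gam, Fin.zero_eta, Fin.mk_one, Fin.reduceFinMk,
      Matrix.of_apply, Matrix.cons_val, Pi.add_apply, Pi.smul_apply, smul_eq_mul] <;>
    field_simp <;> simp only [hρ_eq, Real.cos_sq'] <;> ring

theorem metric_mulVec_kodamaCurrent (M : ℝ → ℝ) (hx : x ∈ domain) :
    metric a M x *ᵥ kodamaCurrent a M x =
      energyFlux a M x 0 • nullCovector a x + energyFlux a M x := by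
  rw [metric_eq_kerrSchild a M hx, Matrix.add_mulVec, Matrix.smul_mulVec,
    Matrix.vecMulVec_mulVec, nullCovector_dotProduct_kodamaCurrent, MulOpposite.op_zero,
    zero_smul, smul_zero, add_zero, flatMetric_mulVec_kodamaCurrent M hx]

theorem current_K (hM : Differentiable ℝ M) (hM' : Differentiable ℝ (deriv M))
    (hx : x ∈ domain) : current (metric a M) K x = kodamaCurrent a M x := by
  have hdet := (isVolumeDensityOn_metric a hM).det_ne_zero hx
  refine Matrix.mulVec_injective_of_isUnit ((Matrix.isUnit_iff_isUnit_det _).2 hdet.isUnit) ?_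
  rw [mulVec_current hdet (isSymm_metric a M x), K, Matrix.mulVec_single_one,
    metric_mulVec_kodamaCurrent M hx]
  ext α
  have hl : nullCovector a x 0 = 1 := rfl
  simp only [Matrix.col_apply, Matrix.of_apply, einstein, scalarCurv_metric hM hM' hx,
    ricci_metric hM hM' hx, hl, Pi.add_apply, Pi.smul_apply, smul_eq_mul]
  ring

theorem current_K_eventuallyEq (hM : Differentiable ℝ M) (hM' : Differentiable ℝ (deriv M))
    (hx : x ∈ domain) : current (metric a M) K =ᶠ[𝓝 x] kodamaCurrent a M :=
  eventually_of_mem (isOpen_domain.mem_nhds hx) fun _ hy => current_K hM hM' hy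

theorem differentiableAt_kodamaCurrent (hM' : Differentiable ℝ (deriv M))
    (hM'' : Differentiable ℝ (deriv (deriv M))) (hx : x ∈ domain) :
    DifferentiableAt ℝ (kodamaCurrent a M) x := by
  have hρ := pow_ne_zero 3 (rhoSq_pos a hx).ne'
  refine differentiableAt_pi.2 fun μ => ?_
  fin_cases μ <;>
    simp only [kodamaCurrent, Fin.zero_eta, Fin.mk_one, Fin.reduceFinMk, Matrix.cons_val] <;>
    fun_prop (disch := assumption)

theorem differentiableAt_current_K (hM : Differentiable ℝ M) (hM' : Differentiable ℝ (deriv M))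
    (hM'' : Differentiable ℝ (deriv (deriv M))) (hx : x ∈ domain) :
    DifferentiableAt ℝ (current (metric a M) K) x :=
  (differentiableAt_kodamaCurrent hM' hM'' hx).congr_of_eventuallyEq
    (current_K_eventuallyEq hM hM' hx)

theorem sum_pd_volumeDensity_mul_kodamaCurrent (hM' : Differentiable ℝ (deriv M))
    (hM'' : Differentiable ℝ (deriv (deriv M))) (hx : x ∈ domain) :
    ∑ μ, pd μ (fun y => volumeDensity a y * kodamaCurrent a M y μ) x = 0 := by
  have hρ := (rhoSq_pos a hx).ne'
  have hρ3 := pow_ne_zero 3 hρ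
  have hρ_eq := rhoSq_eq_sub_sin_sq a x
  simp (disch := first | assumption | fun_prop (disch := assumption)) only [Fin.sum_univ_four,
    kodamaCurrent, volumeDensity, Real.sin_two_mul, Matrix.cons_val, Fin.isValue, pd_div, pd_mul,
    pd_pow, pd_sub, pd_add, pd_neg, pd_const, pd_apply, pd_rhoSq, pd_sin, pd_cos,
    pd_comp_apply _ 0 (deriv M), pd_comp_apply _ 0 (deriv (deriv M)), Fin.reduceEq, reduceIte,
    Nat.cast_ofNat, Nat.reduceSub]
  field_simp
  rw [hρ_eq]
  ring_nf
  simp only [Real.cos_sq']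
  ring

theorem divergence_current_K (hM : Differentiable ℝ M) (hM' : Differentiable ℝ (deriv M))
    (hM'' : Differentiable ℝ (deriv (deriv M))) (hx : x ∈ domain) :
    divergence (metric a M) (current (metric a M) K) x = 0 := by
  have h := isVolumeDensityOn_metric a hM
  have hJ := differentiableAt_pi.1 (differentiableAt_current_K (a := a) hM hM' hM'' hx)
  have hpd (μ : Fin 4) : pd μ (fun y => volumeDensity a y * current (metric a M) K y μ) x
      = pd μ (fun y => volumeDensity a y * kodamaCurrent a M y μ) x :=
    pd_congr μ ((current_K_eventuallyEq hM hM' hx).mono fun y hy =>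
      congrArg (fun J : Fin 4 → ℝ => volumeDensity a y * J μ) hy)
  have hmul := h.mul_divergence hx hJ
  rw [Finset.sum_congr rfl fun μ _ => hpd μ,
    sum_pd_volumeDensity_mul_kodamaCurrent hM' hM'' hx] at hmul
  exact (mul_eq_zero.1 hmul).resolve_left (h.ne_zero x hx)

end Kodama

end KerrVaidya

end

theorem proposition1 (a : ℝ) (M : ℝ → ℝ) (hM : ContDiff ℝ 3 M)
    (x : KerrVaidya.Coord) (hx : x ∈ KerrVaidya.domain) :
    -- `K` is divergence-free
    KerrVaidya.divergence (KerrVaidya.metric a M) KerrVaidya.K x = 0 ∧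
    -- `K` is tangent to the surfaces of constant `r`
    KerrVaidya.along KerrVaidya.K (fun y => y 1) x = 0 ∧
    -- the current `J^a = G^{ab} K_b` is covariantly conserved
    DifferentiableAt ℝ (KerrVaidya.current (KerrVaidya.metric a M) KerrVaidya.K) x ∧
    KerrVaidya.divergence (KerrVaidya.metric a M)
      (KerrVaidya.current (KerrVaidya.metric a M) KerrVaidya.K) x = 0 ∧
    -- the components of the current
    KerrVaidya.current (KerrVaidya.metric a M) KerrVaidya.K x 0 =
      1 / KerrVaidya.rhoSq a x ^ 3 * (a ^ 2 * Real.sin (x 2) ^ 2 *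
        (a ^ 2 * Real.cos (x 2) ^ 2 - x 1 ^ 2) * deriv M (x 0)) ∧
    KerrVaidya.current (KerrVaidya.metric a M) KerrVaidya.K x 1 =
      1 / KerrVaidya.rhoSq a x ^ 3 *
        ((KerrVaidya.rhoSq a x ^ 2 + x 1 ^ 4 + x 1 ^ 2 * a ^ 2 * Real.sin (x 2) ^ 2
            - a ^ 4 * Real.cos (x 2) ^ 2) * deriv M (x 0)
          - x 1 * KerrVaidya.rhoSq a x * a ^ 2 * Real.sin (x 2) ^ 2 *
            deriv (deriv M) (x 0)) ∧
    KerrVaidya.current (KerrVaidya.metric a M) KerrVaidya.K x 2 =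
      -(1 / KerrVaidya.rhoSq a x ^ 3 *
        (x 1 * a ^ 2 * Real.sin (2 * x 2) * deriv M (x 0))) ∧
    KerrVaidya.current (KerrVaidya.metric a M) KerrVaidya.K x 3 =
      1 / KerrVaidya.rhoSq a x ^ 3 *
        (a * (a ^ 2 * Real.cos (x 2) ^ 2 - x 1 ^ 2) * deriv M (x 0)) ∧
    -- `K` is timelike exactly where `2 M(v) r < ρ²`
    (KerrVaidya.normSq (KerrVaidya.metric a M) KerrVaidya.K x < 0 ↔
      2 * M (x 0) * x 1 < KerrVaidya.rhoSq a x) := by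
  have hM' : ContDiff ℝ 2 (deriv M) := hM.deriv'
  have hM'' : ContDiff ℝ 1 (deriv (deriv M)) := hM'.deriv'
  have hd := hM.differentiable (by norm_num)
  have hd' := hM'.differentiable (by norm_num)
  have hd'' := hM''.differentiable one_ne_zero
  have hJ := KerrVaidya.current_K (a := a) hd hd' hx
  have hr : KerrVaidya.along KerrVaidya.K (fun y => y 1) x = 0 := by
    rw [KerrVaidya.along_K, KerrVaidya.pd_apply, if_neg (by decide)]
  exact ⟨KerrVaidya.divergence_K hd hx, hr,
    KerrVaidya.differentiableAt_current_K hd hd' hd'' hx,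
    KerrVaidya.divergence_current_K hd hd' hd'' hx,
    congrFun hJ 0, congrFun hJ 1, congrFun hJ 2, congrFun hJ 3,
    KerrVaidya.normSq_K_neg_iff a M hx⟩
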